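/- Let $n\ge 1$. An interval of type $n$ is a pair of integers $[a,b]$ with $1\le a\le b\le n$. Let $\mathcal I_n$ be the $\mathbb F_2$-linear category whose objects are the intervals of type $n$, with $\operatorname{Hom}([a,b],[c,d])=\mathbb F_2$ if $a\le c\le b\le d$ and $\operatorname{Hom}([a,b],[c,d])=0$ otherwise. Writing $\alpha_{xy}\colon x\to y$ for the non-zero morphism when it exists, the composition is given by $\alpha_{yz}\circ\alpha_{xy}=\alpha_{xz}$ whenever all three morphisms exist, and every other composition is zero. Let $\mathcal A_n$ be the category of finite multisets $x_1\oplus\dots\oplus x_r$ of intervals, where morphisms are matrices of morphisms in $\mathcal I_n$ and composition is matrix multiplication. The category $\mathcal A_n$ is abelian, and its indecomposable objects are, up to isomorphism, the intervals. Let $\mathcal A\subseteq\mathcal A_n$ be a full subcategory that is closed under finite direct sums (including the empty sum $0$, and up to isomorphism) and under direct summands. Suppose that for every morphism $\phi\colon x\to y$ with $x,y\in\mathcal A$, where $x$ is indecomposable and $y$ is either indecomposable or a direct sum of two indecomposable objects, the cokernel of $\phi$ belongs to $\mathcal A$. Then $\mathcal A$ is closed under cokernels: the cokernel of every morphism between objects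 of $\mathcal A$ belongs to $\mathcal A$. Moreover, the cokernels of these morphisms are as follows, with the convention $[b+1,b]=0$. 1. If $\phi\colon[a,b]\to[c,d]$ is non-zero, then $\operatorname{Coker}\phi\cong[b+1,d]$. 2. If $\phi\colon[a,b]\to[c,d]\oplus[c',d']$ is a morphism both of whose components $[a,b]\to[c,d]$ and $[a,b]\to[c',d']$ are non-zero, then $$\operatorname{Coker}\phi\cong[b+1,\min(d,d')]\oplus[\max(c,c'),\max(d,d')].$$ -/

import Mathlib

open CategoryTheory CategoryTheory.Limits

noncomputable section

/-- The intervals `[a, b]` of type `n`: pairs of integers with `1 ≤ a ≤ b ≤ n`. -/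
@[ext]
structure IntervalOfType (n : ℕ) where
  /-- the left end point -/
  left : ℤ
  /-- the right end point -/
  right : ℤ
  one_le_left : 1 ≤ left
  left_le_right : left ≤ right
  right_le : right ≤ n

namespace IntervalOfType

variable {n : ℕ}

/-- For `x = [a, b]` and `y = [c, d]`, the condition `a ≤ c ≤ b ≤ d` under which there is a
non-zero morphism `x ⟶ y`. -/
def Linked (x y : IntervalOfType n) : Prop :=
  x.left ≤ y.left ∧ y.left ≤ x.right ∧ x.right ≤ y.right

instance (x y : IntervalOfType n) : Decidable (Linked x y) := by
  unfold Linked; infer_instance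

/-- The space of morphisms from `x` to `y`: it is `𝔽₂` if `x` and `y` are linked, and `0`
otherwise. -/
def homSpace (x y : IntervalOfType n) : Submodule (ZMod 2) (ZMod 2) :=
  if Linked x y then ⊤ else ⊥

lemma mem_homSpace {x y : IntervalOfType n} {t : ZMod 2} :
    t ∈ homSpace x y ↔ (Linked x y ∨ t = 0) := by
  unfold homSpace; split_ifs with h <;> simp [h]

lemma Linked.refl (x : IntervalOfType n) : Linked x x :=
  ⟨le_rfl, x.left_le_right, le_rfl⟩

/-- Composition: `α_{xy}` followed by `α_{yz}` is `α_{xz}` if `x` and `z` are linked, and every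
other composition is zero. -/
def homComp {x y z : IntervalOfType n} (f : homSpace x y) (g : homSpace y z) : homSpace x z :=
  ⟨if Linked x z then (f : ZMod 2) * g else 0, by
    rw [mem_homSpace]; split_ifs with h <;> simp [h]⟩

/-- The category of intervals of type `n`. -/
instance : Category (IntervalOfType n) where
  Hom x y := homSpace x y
  id x := ⟨1, mem_homSpace.2 (Or.inl (Linked.refl x))⟩
  comp f g := homComp f g
  id_comp {x y} f := by
    apply Subtype.ext
    rcases mem_homSpace.1 f.2 with h | h <;> simp [homComp, h]
  comp_id {x y} f := by
    apply Subtype.ext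
    rcases mem_homSpace.1 f.2 with h | h <;> simp [homComp, h]
  assoc {w x y z} f g h := by
    apply Subtype.ext
    rcases mem_homSpace.1 f.2 with hf | hf
    · rcases mem_homSpace.1 g.2 with hg | hg
      · rcases mem_homSpace.1 h.2 with hh | hh
        · by_cases hz : Linked w z
          · have h1 : Linked w y := by unfold Linked at *; omega
            have h2 : Linked x z := by unfold Linked at *; omega
            simp [homComp, hz, h1, h2, mul_assoc]
          · simp [homComp, hz]
        · simp [homComp, hh]
      · simp [homComp, hg]
    · simp [homComp, hf]

instance : Preadditive (IntervalOfType n) where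
  homGroup x y := inferInstanceAs (AddCommGroup (homSpace x y))
  add_comp x y z f f' g := by
    apply Subtype.ext
    change (if Linked x z then ((f.1 + f'.1 : ZMod 2)) * g.1 else 0) =
      (if Linked x z then f.1 * g.1 else 0) + (if Linked x z then f'.1 * g.1 else 0)
    split_ifs <;> simp [add_mul]
  comp_add x y z f g g' := by
    apply Subtype.ext
    change (if Linked x z then f.1 * ((g.1 + g'.1 : ZMod 2)) else 0) =
      (if Linked x z then f.1 * g.1 else 0) + (if Linked x z then f.1 * g'.1 else 0)
    split_ifs <;> simp [mul_add]

end IntervalOfType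

/-- The category `𝒜_n` of multisets of intervals of type `n`: an object is a finite family of
intervals, and a morphism is a matrix of morphisms of intervals. -/
abbrev MultisetsOfIntervals (n : ℕ) : Type 1 := Mat_ (IntervalOfType n)

namespace MultisetsOfIntervals

instance (n : ℕ) : HasBinaryBiproducts (MultisetsOfIntervals n) :=
  hasBinaryBiproducts_of_finite_biproducts _

variable {n : ℕ}

/-- An interval as an object of `𝒜_n` (the multiset with this single element). -/
abbrev single (x : IntervalOfType n) : MultisetsOfIntervals n :=
  (Mat_.embedding (IntervalOfType n)).obj x

/-- The object `[s, t]` of `𝒜_n`, which is the empty multiset (the zero object) if `[s, t]` is not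
an interval of type `n`; in particular `[b + 1, b] = 0`. -/
def ofEnds (n : ℕ) (s t : ℤ) : MultisetsOfIntervals n :=
  if h : 1 ≤ s ∧ s ≤ t ∧ t ≤ n then single ⟨s, t, h.1, h.2.1, h.2.2⟩
  else { ι := Empty, X := Empty.elim }

/-- `φ` has a cokernel whose underlying object is `Z`. -/
def IsCokernelObject {X Y : MultisetsOfIntervals n} (φ : X ⟶ Y) (Z : MultisetsOfIntervals n) :
    Prop :=
  ∃ (π : Y ⟶ Z) (w : φ ≫ π = 0), Nonempty (IsColimit (CokernelCofork.ofπ π w))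

end MultisetsOfIntervals

/-- A full subcategory of `𝒜_n` (given by its objects) that is closed under finite direct sums
(including the empty one, and direct sums being formed up to isomorphism) and under direct
summands. -/
structure IsAdditiveSubcategory {n : ℕ} (P : ObjectProperty (MultisetsOfIntervals n)) :
    Prop where
  directSums : P.IsClosedUnderFiniteCoproducts
  summands : ∀ X Y : MultisetsOfIntervals n, P (X ⊞ Y) → P X

end

/-! Induction on the number of intervals in the source reduces to a single interval `x = [a,b]`: the
cokernel of a map from `X₁ ⊞ X₂` is obtained by dividing out the image of `X₁`, then that of `X₂`
(`isCokernelObject_of_biprod`), and the intermediate quotient stays in the subcategory.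

For `f : x ⟶ ⨁ [c_j,d_j]`, induct on the number of targets. A target with zero component splits off.
Otherwise pick `i` with `d_i` maximal and, among the other targets, `k` with `c_k` minimal. Then
`Coker f` is `[max c_i c_k, d_i]` plus the cokernel of `f` with component `i` removed
(`isCokernelObject_lift_single`). The new interval is also a summand of the cokernel of `x ⟶
[c_i,d_i] ⊕ [c_k,d_k]`, so it lies in the subcategory by hypothesis. The explicit formulas are the
cases of one and two targets. -/

noncomputable section

/-! ### Morphisms between intervals. -/

namespace IntervalOfType

variable {n : ℕ}

/-- The non-zero morphism from `x` to `y` if there is one, and zero otherwise. -/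
def alpha (x y : IntervalOfType n) : x ⟶ y :=
  (⟨if Linked x y then 1 else 0, by rw [mem_homSpace]; split_ifs with h <;> simp [h]⟩ :
    homSpace x y)

lemma val_alpha (x y : IntervalOfType n) :
    Subtype.val (p := (· ∈ homSpace x y)) (alpha x y) = if Linked x y then 1 else 0 := rfl

lemma val_comp {x y z : IntervalOfType n} (f : x ⟶ y) (g : y ⟶ z) :
    Subtype.val (p := (· ∈ homSpace x z)) (f ≫ g) =
      if Linked x z then Subtype.val (p := (· ∈ homSpace x y)) f *
        Subtype.val (p := (· ∈ homSpace y z)) g else 0 := rfl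

lemma val_zero (x y : IntervalOfType n) :
    Subtype.val (p := (· ∈ homSpace x y)) (0 : x ⟶ y) = 0 := rfl

lemma hom_ext {x y : IntervalOfType n} {f g : x ⟶ y}
    (h : Subtype.val (p := (· ∈ homSpace x y)) f = Subtype.val (p := (· ∈ homSpace x y)) g) :
    f = g := Subtype.ext h

lemma eq_zero_or_eq_alpha {x y : IntervalOfType n} (f : x ⟶ y) :
    f = 0 ∨ Linked x y ∧ f = alpha x y := by
  rcases (by decide : ∀ t : ZMod 2, t = 0 ∨ t = 1)
    (Subtype.val (p := (· ∈ homSpace x y)) f) with h | h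
  · exact Or.inl (hom_ext h)
  · have hl : Linked x y := (mem_homSpace.1 f.2).resolve_right (by rw [h]; decide)
    exact Or.inr ⟨hl, hom_ext (by rw [h, val_alpha, if_pos hl])⟩

lemma linked_of_ne_zero {x y : IntervalOfType n} {f : x ⟶ y} (h : f ≠ 0) : Linked x y :=
  ((eq_zero_or_eq_alpha f).resolve_left h).1

lemma eq_alpha_of_ne_zero {x y : IntervalOfType n} {f : x ⟶ y} (h : f ≠ 0) : f = alpha x y :=
  ((eq_zero_or_eq_alpha f).resolve_left h).2

lemma eq_zero_of_not_linked {x y : IntervalOfType n} (h : ¬ Linked x y) (f : x ⟶ y) : f = 0 :=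
  by_contra fun hf => h (linked_of_ne_zero hf)

lemma alpha_ne_zero {x y : IntervalOfType n} (h : Linked x y) : alpha x y ≠ 0 := fun h0 => by
  have := congrArg (Subtype.val (p := (· ∈ homSpace x y))) h0
  rw [val_alpha, if_pos h, val_zero] at this
  exact one_ne_zero this

lemma alpha_comp_alpha {x y z : IntervalOfType n} (hxy : Linked x y) (hyz : Linked y z)
    (hxz : Linked x z) : alpha x y ≫ alpha y z = alpha x z := by
  apply hom_ext
  rw [val_comp, val_alpha, val_alpha, val_alpha, if_pos hxy, if_pos hyz, if_pos hxz,
    if_pos hxz, mul_one]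

lemma comp_ne_zero {x y z : IntervalOfType n} {f : x ⟶ y} {g : y ⟶ z} (hf : f ≠ 0) (hg : g ≠ 0)
    (h : Linked x z) : f ≫ g ≠ 0 := by
  rw [eq_alpha_of_ne_zero hf, eq_alpha_of_ne_zero hg,
    alpha_comp_alpha (linked_of_ne_zero hf) (linked_of_ne_zero hg) h]
  exact alpha_ne_zero h

lemma add_self {x y : IntervalOfType n} (f : x ⟶ y) : f + f = 0 :=
  hom_ext (CharTwo.add_self_eq_zero (Subtype.val (p := (· ∈ homSpace x y)) f))

/-- A morphism out of `y` factors through the quotient `z` of `y` as soon as its target is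
linked to `z`. -/
lemma exists_alpha_comp_eq {y z w : IntervalOfType n} (hyz : Linked y z) (g : y ⟶ w)
    (hg : g ≠ 0 → Linked z w) : ∃ h, alpha y z ≫ h = g := by
  by_cases h0 : g = 0
  · exact ⟨0, by simp [h0]⟩
  · refine ⟨alpha z w, ?_⟩
    rw [alpha_comp_alpha hyz (hg h0) (linked_of_ne_zero h0), ← eq_alpha_of_ne_zero h0]

/-- With equal right ends, any interval linked from `z` is also linked from `y`, so no non-zero
morphism is killed: `y ⟶ z` behaves as a quotient map. -/
lemma eq_zero_of_alpha_comp_eq_zero {y z w : IntervalOfType n} (hyz : Linked y z)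
    (hr : z.right = y.right) (g : z ⟶ w) (h : alpha y z ≫ g = 0) : g = 0 := by
  by_contra hg
  refine comp_ne_zero (alpha_ne_zero hyz) hg ?_ h
  have := linked_of_ne_zero hg
  unfold Linked at *
  omega

end IntervalOfType

/-! ### Morphisms out of one-element multisets. -/

namespace MultisetsOfIntervals

open IntervalOfType

variable {n : ℕ}

lemma single_comp_apply {x y : IntervalOfType n} {W : MultisetsOfIntervals n}
    (f : single x ⟶ single y) (g : single y ⟶ W) (i : PUnit) (k : W.ι) :
    (f ≫ g) i k = f PUnit.unit PUnit.unit ≫ g PUnit.unit k :=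
  Fintype.sum_unique fun j : PUnit => (show x ⟶ y from f i j) ≫ (show y ⟶ W.X k from g j k)

lemma single_ne_zero {x y : IntervalOfType n} {f : single x ⟶ single y} (h : f ≠ 0) :
    f PUnit.unit PUnit.unit ≠ 0 := fun h0 => h (by ext ⟨⟩ ⟨⟩; exact h0)

/-- The morphism of one-element multisets given by `alpha x y`. -/
def singleAlpha (x y : IntervalOfType n) : single x ⟶ single y := fun _ _ => alpha x y

lemma epi_singleAlpha {y z : IntervalOfType n} (hyz : Linked y z) (hr : z.right = y.right) :
    Epi (singleAlpha y z) := by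
  refine Preadditive.epi_of_cancel_zero _ fun {W} g hg => ?_
  ext ⟨⟩ k
  refine eq_zero_of_alpha_comp_eq_zero hyz hr _ ?_
  have := congrFun (congrFun hg PUnit.unit) k
  rwa [single_comp_apply] at this

lemma exists_singleAlpha_comp_eq {y z : IntervalOfType n} {W : MultisetsOfIntervals n}
    (hyz : Linked y z) (g : single y ⟶ W)
    (hg : ∀ k, g PUnit.unit k ≠ 0 → Linked z (W.X k)) : ∃ h, singleAlpha y z ≫ h = g := by
  choose h hh using fun k => exists_alpha_comp_eq hyz (g PUnit.unit k) (hg k)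
  refine ⟨fun _ k => h k, ?_⟩
  ext ⟨⟩ k
  exact (single_comp_apply _ _ _ _).trans (hh k)

/-! ### Cokernels and direct sums. -/

section Cokernel

variable {X Y Z : MultisetsOfIntervals n}

/-- Uniqueness of the factorisation is traded for `Epi π`, so only existence of factorisations has
to be checked later. -/
lemma isCokernelObject_iff {φ : X ⟶ Y} :
    IsCokernelObject φ Z ↔ ∃ π : Y ⟶ Z, φ ≫ π = 0 ∧ Epi π ∧
      ∀ (W : MultisetsOfIntervals n) (g : Y ⟶ W), φ ≫ g = 0 → ∃ h, π ≫ h = g := by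
  constructor
  · rintro ⟨π, w, ⟨hk⟩⟩
    exact ⟨π, w, Cofork.IsColimit.epi hk, fun W g hg =>
      ⟨_, (CokernelCofork.IsColimit.desc' hk g hg).2⟩⟩
  · rintro ⟨π, w, _, h⟩
    exact ⟨π, w, ⟨CokernelCofork.IsColimit.ofπ π w (fun {W} g hg => (h W g hg).choose)
      (fun {W} g hg => (h W g hg).choose_spec) (fun {W} g hg m hm => by
        rw [← cancel_epi π, hm, (h W g hg).choose_spec])⟩⟩

lemma IsCokernelObject.of_target_iso {Y' : MultisetsOfIntervals n} {φ : X ⟶ Y} (e : Y ≅ Y')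
    (h : IsCokernelObject (φ ≫ e.hom) Z) : IsCokernelObject φ Z := by
  rw [isCokernelObject_iff] at h ⊢
  obtain ⟨π, w, _, h⟩ := h
  refine ⟨e.hom ≫ π, by simpa using w, inferInstance, fun W g hg => ?_⟩
  obtain ⟨t, ht⟩ := h W (e.inv ≫ g) (by simpa using hg)
  exact ⟨t, by simp [ht]⟩

lemma IsCokernelObject.of_iso {Z' : MultisetsOfIntervals n} {φ : X ⟶ Y}
    (h : IsCokernelObject φ Z) (e : Z ≅ Z') : IsCokernelObject φ Z' := by
  rw [isCokernelObject_iff] at h ⊢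
  obtain ⟨π, w, _, h⟩ := h
  refine ⟨π ≫ e.hom, by simp [reassoc_of% w], inferInstance, fun W g hg => ?_⟩
  obtain ⟨t, ht⟩ := h W g hg
  exact ⟨e.inv ≫ t, by simp [ht]⟩

/-- Cokernels out of a direct sum can be computed one summand at a time. -/
lemma isCokernelObject_of_biprod {X₁ X₂ Z₁ Z₂ : MultisetsOfIntervals n} (e : X ≅ X₁ ⊞ X₂)
    (φ : X ⟶ Y) (π : Y ⟶ Z₁) (w : (biprod.inl ≫ e.inv ≫ φ) ≫ π = 0) [Epi π]
    (hπ : ∀ (W : MultisetsOfIntervals n) (g : Y ⟶ W), (biprod.inl ≫ e.inv ≫ φ) ≫ g = 0 →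
      ∃ h, π ≫ h = g)
    (h : IsCokernelObject ((biprod.inr ≫ e.inv ≫ φ) ≫ π) Z₂) : IsCokernelObject φ Z₂ := by
  rw [isCokernelObject_iff] at h ⊢
  obtain ⟨ρ, w', _, h⟩ := h
  refine ⟨π ≫ ρ, ?_, inferInstance, fun W g hg => ?_⟩
  · rw [← cancel_epi e.inv]
    apply biprod.hom_ext'
    · simpa using w =≫ ρ
    · simpa using w'
  · obtain ⟨t, ht⟩ := hπ W g (by simp [hg])
    obtain ⟨s, hs⟩ := h W t (by simp [ht, hg])
    exact ⟨s, by simp [hs, ht]⟩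

/-- If `a` is an epimorphism such that `f₁ ≫ a` factors through `f₂`, up to sign, in a way which
is weakly universal, then it splits off as a summand of the cokernel. -/
lemma isCokernelObject_lift {Y₁ Y₂ Z₁ Z₂ : MultisetsOfIntervals n} {f₁ : X ⟶ Y₁} {f₂ : X ⟶ Y₂}
    (a : Y₁ ⟶ Z₁) [Epi a] (b : Y₂ ⟶ Z₁) (hab : f₁ ≫ a + f₂ ≫ b = 0)
    (ha : ∀ (W : MultisetsOfIntervals n) (g₁ : Y₁ ⟶ W) (g₂ : Y₂ ⟶ W),
      f₁ ≫ g₁ + f₂ ≫ g₂ = 0 → ∃ h, a ≫ h = g₁)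
    (h : IsCokernelObject f₂ Z₂) : IsCokernelObject (biprod.lift f₁ f₂) (Z₁ ⊞ Z₂) := by
  rw [isCokernelObject_iff] at h ⊢
  obtain ⟨q, w, _, h⟩ := h
  refine ⟨biprod.lift (biprod.desc a b) (biprod.snd ≫ q), ?_, ?_, fun W g hg => ?_⟩
  · apply biprod.hom_ext <;> simp [hab, w]
  · refine Preadditive.epi_of_cancel_zero _ fun {W} g hg => ?_
    have h1 : a ≫ biprod.inl ≫ g = 0 := by
      have := biprod.inl ≫= hg
      simpa [biprod.lift_eq] using this
    have h1' := (cancel_epi a).1 (h1.trans comp_zero.symm)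
    have h2 : q ≫ biprod.inr ≫ g = 0 := by
      have := biprod.inr ≫= hg
      simpa [biprod.lift_eq, h1'] using this
    apply biprod.hom_ext' <;> simp [h1', (cancel_epi q).1 (h2.trans comp_zero.symm)]
  · have hg' : f₁ ≫ biprod.inl ≫ g + f₂ ≫ biprod.inr ≫ g = 0 := by
      simpa [biprod.lift_eq] using hg
    obtain ⟨s, hs⟩ := ha W _ _ hg'
    -- Subtracting `b ≫ s` removes the part of `g` coming from `Z₁`; the remainder is killed by
    -- `f₂`.
    obtain ⟨t, ht⟩ := h W (biprod.inr ≫ g - b ≫ s) (by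
      rw [Preadditive.comp_sub, ← sub_eq_zero.2 hg', ← hs]
      have := hab =≫ s
      simp only [Preadditive.add_comp, Category.assoc, zero_comp] at this
      rw [eq_neg_of_add_eq_zero_left this]
      abel)
    refine ⟨biprod.desc s t, ?_⟩
    apply biprod.hom_ext'
    · simp [hs, biprod.lift_eq]
    · simp [biprod.lift_eq, ht]

end Cokernel

/-! ### Splitting off one member of a multiset. -/

/-- The multiset `M` without its member with index `i`. -/
def erase (M : MultisetsOfIntervals n) (i : M.ι) : MultisetsOfIntervals n :=
  letI := Classical.decEq M.ι
  { ι := {j : M.ι // j ≠ i}, X := fun j => M.X j }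

/-- The projection of a multiset onto one of its members. -/
def projSingle (M : MultisetsOfIntervals n) (i : M.ι) : M ⟶ single (M.X i) :=
  fun j _ => (𝟙 M : Mat_.Hom M M) j i

/-- The inclusion of a member of a multiset. -/
def inclSingle (M : MultisetsOfIntervals n) (i : M.ι) : single (M.X i) ⟶ M :=
  fun _ j => (𝟙 M : Mat_.Hom M M) i j

/-- The projection of a multiset onto the complement of one of its members. -/
def projErase (M : MultisetsOfIntervals n) (i : M.ι) : M ⟶ erase M i :=
  fun j k => (𝟙 M : Mat_.Hom M M) j k.1

/-- The inclusion of the complement of a member of a multiset. -/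
def inclErase (M : MultisetsOfIntervals n) (i : M.ι) : erase M i ⟶ M :=
  fun k j => (𝟙 M : Mat_.Hom M M) k.1 j

section Erase

variable (M : MultisetsOfIntervals n) (i : M.ι)

lemma sum_id_comp_id (j k : M.ι) :
    ∑ l, (𝟙 M : Mat_.Hom M M) j l ≫ (𝟙 M : Mat_.Hom M M) l k = (𝟙 M : Mat_.Hom M M) j k :=
  congrFun (congrFun (Category.id_comp (𝟙 M)) j) k

lemma comp_projSingle_apply {K : MultisetsOfIntervals n} (f : K ⟶ M) (k : K.ι) (u : PUnit) :
    (f ≫ projSingle M i) k u = f k i :=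
  congrFun (congrFun (Category.comp_id f) k) i

lemma comp_projErase_apply {K : MultisetsOfIntervals n} (f : K ⟶ M) (k : K.ι)
    (l : (erase M i).ι) : (f ≫ projErase M i) k l = f k l.1 :=
  congrFun (congrFun (Category.comp_id f) k) l.1

lemma inclSingle_projSingle : inclSingle M i ≫ projSingle M i = 𝟙 _ := by
  ext ⟨⟩ ⟨⟩
  refine (comp_projSingle_apply M i _ _ _).trans ?_
  exact (Mat_.id_apply_self M i).trans (Mat_.id_apply_self (single (M.X i)) PUnit.unit).symm

lemma inclSingle_projErase : inclSingle M i ≫ projErase M i = 0 := by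
  ext ⟨⟩ k
  refine (comp_projErase_apply M i _ _ _).trans ?_
  exact Mat_.id_apply_of_ne M i k.1 k.2.symm

lemma inclErase_projSingle : inclErase M i ≫ projSingle M i = 0 := by
  ext k ⟨⟩
  refine (comp_projSingle_apply M i _ _ _).trans ?_
  exact Mat_.id_apply_of_ne M k.1 i k.2

lemma inclErase_projErase : inclErase M i ≫ projErase M i = 𝟙 _ := by
  ext k l
  refine (comp_projErase_apply M i _ _ _).trans ?_
  by_cases h : k = l
  · subst h
    exact (Mat_.id_apply_self M k.1).trans (Mat_.id_apply_self (erase M i) k).symm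
  · exact (Mat_.id_apply_of_ne M k.1 l.1 fun h' => h (Subtype.ext h')).trans
      (Mat_.id_apply_of_ne (erase M i) k l h).symm

lemma projSingle_inclSingle_add :
    projSingle M i ≫ inclSingle M i + projErase M i ≫ inclErase M i = 𝟙 M := by
  classical
  ext j k
  refine Eq.trans ?_ (sum_id_comp_id M j k)
  rw [Fintype.sum_eq_add_sum_subtype_ne _ i]
  refine congrArg₂ (fun a b : M.X j ⟶ M.X k => a + b) (Fintype.sum_unique fun _ : PUnit =>
    (𝟙 M : Mat_.Hom M M) j i ≫ (𝟙 M : Mat_.Hom M M) i k) ?_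
  exact Finset.sum_congr (Finset.ext fun _ =>
    iff_of_true (Finset.mem_univ _) (Finset.mem_univ _)) fun _ _ => rfl

/-- A multiset is the direct sum of any of its members and the remaining ones. -/
def isoSingleBiprodErase : M ≅ single (M.X i) ⊞ erase M i where
  hom := biprod.lift (projSingle M i) (projErase M i)
  inv := biprod.desc (inclSingle M i) (inclErase M i)
  hom_inv_id := (biprod.lift_desc).trans (projSingle_inclSingle_add M i)
  inv_hom_id := by
    apply biprod.hom_ext' <;> apply biprod.hom_ext <;>
      simp [inclSingle_projSingle, inclSingle_projErase, inclErase_projSingle,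
        inclErase_projErase]

end Erase

/-! ### Induction on multisets and indecomposability of intervals. -/

/-- Multisets with no members are zero. -/
lemma isZero_of_isEmpty (M : MultisetsOfIntervals n) [IsEmpty M.ι] : IsZero M := by
  rw [IsZero.iff_id_eq_zero]
  ext i
  exact isEmptyElim i

lemma card_erase (M : MultisetsOfIntervals n) (i : M.ι) :
    Fintype.card (erase M i).ι + 1 = Fintype.card M.ι := by
  classical
  have h : Fintype.card (erase M i).ι = Fintype.card {j : M.ι // j ≠ i} :=
    Fintype.card_congr (Equiv.refl _)
  have h' := Fintype.card_subtype_compl (fun j : M.ι => j = i)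
  rw [Fintype.card_subtype_eq] at h'
  have := Fintype.card_pos_iff.2 ⟨i⟩
  change Fintype.card {j : M.ι // j ≠ i} = _ at h'
  omega

/-- The step allows every decomposition up to isomorphism, so `Q` need not be known to be
isomorphism-invariant. -/
lemma induction_on {Q : MultisetsOfIntervals n → Prop} (zero : ∀ M, IsZero M → Q M)
    (biprod : ∀ (M M' : MultisetsOfIntervals n) (x : IntervalOfType n), (M ≅ single x ⊞ M') →
      Q M' → Q M) (M : MultisetsOfIntervals n) : Q M := by
  induction h : Fintype.card M.ι generalizing M with
  | zero =>
    have := Fintype.card_eq_zero_iff.1 h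
    exact zero M (isZero_of_isEmpty M)
  | succ k ih =>
    obtain ⟨i⟩ := Fintype.card_pos_iff.1 (by omega : 0 < Fintype.card M.ι)
    exact biprod M _ _ (isoSingleBiprodErase M i) (ih _ (by have := card_erase M i; omega))

lemma not_isZero_single (x : IntervalOfType n) : ¬ IsZero (single x) := fun h => by
  have h1 := (IsZero.iff_id_eq_zero _).1 h
  have h2 : 𝟙 x = 0 := (Mat_.id_apply_self (single x) PUnit.unit).symm.trans
    (congrFun (congrFun h1 PUnit.unit) PUnit.unit)
  have := congrArg (Subtype.val (p := (· ∈ homSpace x x))) h2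
  exact one_ne_zero (α := ZMod 2) this

lemma eq_zero_or_eq_id {x : IntervalOfType n} (f : single x ⟶ single x) : f = 0 ∨ f = 𝟙 _ := by
  have h : ∀ g : x ⟶ x, g = 0 ∨ g = 𝟙 x := fun g => by
    rcases eq_zero_or_eq_alpha g with h | ⟨_, h⟩
    · exact Or.inl h
    · rcases eq_zero_or_eq_alpha (𝟙 x) with h' | ⟨_, h'⟩
      · exact Or.inl (by rw [← Category.comp_id g, h', comp_zero])
      · exact Or.inr (h.trans h'.symm)
  rcases h (f PUnit.unit PUnit.unit) with h | h
  · exact Or.inl (by ext ⟨⟩ ⟨⟩; exact h)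
  · refine Or.inr ?_
    ext ⟨⟩ ⟨⟩
    exact h.trans (Mat_.id_apply_self (single x) PUnit.unit).symm

/-- The endomorphism ring is `𝔽₂`, so the idempotent projecting onto `Y` is zero or the identity,
which kills `Y` or `Z`. -/
lemma indecomposable_single (x : IntervalOfType n) : Indecomposable (single x) := by
  refine ⟨not_isZero_single x, fun Y Z e => ?_⟩
  rcases eq_zero_or_eq_id (e.hom ≫ biprod.fst ≫ biprod.inl ≫ e.inv) with h | h
  · left
    rw [IsZero.iff_id_eq_zero]
    have := (biprod.inl ≫ e.inv) ≫= h =≫ (e.hom ≫ biprod.fst)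
    simpa using this
  · right
    rw [IsZero.iff_id_eq_zero]
    have := (biprod.inr ≫ e.inv) ≫= h =≫ (e.hom ≫ biprod.snd)
    simpa using this.symm

end MultisetsOfIntervals

/-! ### Explicit cokernels. -/

namespace MultisetsOfIntervals

open IntervalOfType

variable {n : ℕ}

lemma ofEnds_eq_single {s t : ℤ} (h : 1 ≤ s ∧ s ≤ t ∧ t ≤ n) :
    ofEnds n s t = single ⟨s, t, h.1, h.2.1, h.2.2⟩ := dif_pos h

lemma ofEnds_isZero {s t : ℤ} (h : ¬ (1 ≤ s ∧ s ≤ t ∧ t ≤ n)) : IsZero (ofEnds n s t) := by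
  have : ofEnds n s t = { ι := Empty, X := Empty.elim } := dif_neg h
  rw [this]
  have : IsEmpty ({ ι := Empty, X := Empty.elim } : MultisetsOfIntervals n).ι :=
    inferInstanceAs (IsEmpty Empty)
  exact isZero_of_isEmpty _

/-- A non-zero `y ⟶ w` is killed by `φ` exactly when `w` starts to the right of `x.right`, that is,
when it factors through `[x.right + 1, y.right]`. -/
lemma isCokernelObject_single_single {x y : IntervalOfType n} (φ : single x ⟶ single y)
    (hφ : φ ≠ 0) : IsCokernelObject φ (ofEnds n (x.right + 1) y.right) := by
  have hφ' := single_ne_zero hφ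
  have hl : Linked x y := linked_of_ne_zero hφ'
  have := x.one_le_left; have := x.left_le_right; have := y.right_le
  have linked_of_comp {W : MultisetsOfIntervals n} (g : single y ⟶ W) (hg : φ ≫ g = 0) (k : W.ι)
      (hk : g PUnit.unit k ≠ 0) : Linked y (W.X k) ∧ x.right < (W.X k).left := by
    have hy : Linked y (W.X k) := linked_of_ne_zero hk
    refine ⟨hy, not_le.1 fun hle => ?_⟩
    refine comp_ne_zero (x := x) (z := W.X k) hφ' hk (by unfold Linked at *; omega) ?_
    exact (single_comp_apply _ _ _ _).symm.trans (congrFun (congrFun hg PUnit.unit) k)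
  rw [isCokernelObject_iff]
  by_cases h : 1 ≤ x.right + 1 ∧ x.right + 1 ≤ y.right ∧ y.right ≤ n
  · rw [ofEnds_eq_single h]
    set z : IntervalOfType n := ⟨x.right + 1, y.right, h.1, h.2.1, h.2.2⟩
    have hyz : Linked y z := by unfold Linked at *; simp only [z]; omega
    refine ⟨singleAlpha y z, ?_, epi_singleAlpha hyz rfl, fun W g hg => ?_⟩
    · ext ⟨⟩ ⟨⟩
      exact eq_zero_of_not_linked (x := x) (y := z) (by unfold Linked; simp only [z]; omega) _
    · refine exists_singleAlpha_comp_eq hyz g fun k hk => ?_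
      have := linked_of_comp g hg k hk
      unfold Linked at *
      simp only [z]
      omega
  -- Here `x.right = y.right`, so no non-zero morphism out of `y` is killed and `φ` is an
  -- epimorphism.
  · have h0 := ofEnds_isZero h
    have hzero {W : MultisetsOfIntervals n} (g : single y ⟶ W) (hg : φ ≫ g = 0) : g = 0 := by
      ext ⟨⟩ k
      by_contra hk
      have := linked_of_comp g hg k hk
      unfold Linked at *
      omega
    refine ⟨0, comp_zero, ⟨fun a b _ => h0.eq_of_src a b⟩, fun W g hg => ⟨0, ?_⟩⟩
    rw [hzero g hg, comp_zero]

/-- Let `f₁ : [a, b] ⟶ [c₁, d₁]` and `f₂ : [a, b] ⟶ ⨁ [c_j, d_j]`. If `[c₂, d₂]` is such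
that `d₂ ≤ d₁` and `c₂` is the smallest left end point in the second multiset, then the
interval `[max c₁ c₂, d₁]` splits off from the cokernel of `(f₁, f₂)`, and the other summand is the
cokernel of `f₂`. -/
lemma isCokernelObject_lift_single {x y z : IntervalOfType n} {Y Z : MultisetsOfIntervals n}
    {f₁ : single x ⟶ single y} {f₂ : single x ⟶ Y} (i : Y.ι) (h₁ : f₁ ≠ 0)
    (h₂ : f₂ PUnit.unit i ≠ 0) (hi : (Y.X i).right ≤ y.right)
    (hmin : ∀ j, f₂ PUnit.unit j ≠ 0 → (Y.X i).left ≤ (Y.X j).left)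
    (hzl : z.left = max y.left (Y.X i).left) (hzr : z.right = y.right)
    (h : IsCokernelObject f₂ Z) : IsCokernelObject (biprod.lift f₁ f₂) (single z ⊞ Z) := by
  classical
  have h₁' := single_ne_zero h₁
  have hl₁ : Linked x y := linked_of_ne_zero h₁'
  have hl₂ : Linked x (Y.X i) := linked_of_ne_zero h₂
  have := y.left_le_right
  have hyz : Linked y z := by unfold Linked at *; simp [hzl, hzr] at *; omega
  have hiz : Linked (Y.X i) z := by unfold Linked at *; simp [hzl, hzr] at *; omega
  have hxz : Linked x z := by unfold Linked at *; simp [hzl, hzr] at *; omega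
  have := epi_singleAlpha hyz hzr
  -- Only the component at `i` is used; both composites `x ⟶ z` are then `alpha x z`, and their sum
  -- vanishes in characteristic 2.
  let b : Y ⟶ single z := fun j _ => if j = i then alpha (Y.X j) z else 0
  refine isCokernelObject_lift (singleAlpha y z) b ?_ (fun W g₁ g₂ hg => ?_) h
  · ext ⟨⟩ ⟨⟩
    have e₁ : (f₁ ≫ singleAlpha y z) PUnit.unit PUnit.unit = alpha x z := by
      refine (single_comp_apply _ _ _ _).trans ?_
      rw [eq_alpha_of_ne_zero h₁']
      exact alpha_comp_alpha hl₁ hyz hxz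
    have e₂ : (f₂ ≫ b) PUnit.unit PUnit.unit = alpha x z := by
      have hb : b i PUnit.unit = alpha (Y.X i) z := if_pos rfl
      refine (Finset.sum_eq_single i (fun j _ hj => ?_) (by simp)).trans ?_
      · have hb' : b j PUnit.unit = 0 := if_neg hj
        rw [hb', comp_zero]
      · rw [eq_alpha_of_ne_zero h₂, hb]
        exact alpha_comp_alpha hl₂ hiz hxz
    exact (congrArg₂ (· + ·) e₁ e₂).trans (add_self _)
  · refine exists_singleAlpha_comp_eq hyz g₁ fun k hk => ?_
    have hlk : Linked y (W.X k) := linked_of_ne_zero hk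
    by_contra hzk
    -- Since `y` is linked to `W.X k`, failure for `z` can only come from the left end. Then `f₁ ≫
    -- g₁` is non-zero at `k`, while by minimality of `(Y.X i).left` no `Y.X j` with non-zero
    -- component maps to `W.X k`, so nothing cancels it.
    have hlt : (W.X k).left < (Y.X i).left := by
      unfold Linked at *; simp [hzl, hzr] at *; omega
    have hne : f₁ PUnit.unit PUnit.unit ≫ g₁ PUnit.unit k ≠ 0 :=
      comp_ne_zero (x := x) (z := W.X k) h₁' hk (by unfold Linked at *; omega)
    have hsum : f₁ PUnit.unit PUnit.unit ≫ g₁ PUnit.unit k +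
        ∑ j, f₂ PUnit.unit j ≫ g₂ j k = 0 :=
      (congrArg (· + _) (single_comp_apply f₁ g₁ PUnit.unit k).symm).trans
        (congrFun (congrFun hg PUnit.unit) k)
    refine hne ?_
    rw [← hsum, Finset.sum_eq_zero, add_zero]
    intro j _
    by_cases hj : f₂ PUnit.unit j = 0
    · rw [hj, zero_comp]
    · by_cases hj' : g₂ j k = 0
      · rw [hj', comp_zero]
      · have := hmin j hj
        have := linked_of_ne_zero hj'
        unfold Linked at *
        omega

lemma isCokernelObject_lift_single_single {x y y' : IntervalOfType n} {f : single x ⟶ single y}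
    {f' : single x ⟶ single y'} (h : f ≠ 0) (h' : f' ≠ 0) (hd : y'.right ≤ y.right)
    {z : IntervalOfType n} (hzl : z.left = max y.left y'.left) (hzr : z.right = y.right) :
    IsCokernelObject (biprod.lift f f') (single z ⊞ ofEnds n (x.right + 1) y'.right) :=
  isCokernelObject_lift_single (Y := single y') PUnit.unit h (single_ne_zero h') hd
    (fun _ _ => le_rfl) hzl hzr (isCokernelObject_single_single f' h')

lemma isCokernelObject_single_biprod {x y y' : IntervalOfType n}
    (φ : single x ⟶ single y ⊞ single y') (h : φ ≫ biprod.fst ≠ 0) (h' : φ ≫ biprod.snd ≠ 0) :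
    IsCokernelObject φ (ofEnds n (x.right + 1) (min y.right y'.right) ⊞
      ofEnds n (max y.left y'.left) (max y.right y'.right)) := by
  have hl : Linked x y := linked_of_ne_zero (single_ne_zero h)
  have hl' : Linked x y' := linked_of_ne_zero (single_ne_zero h')
  have := y.one_le_left; have := y.right_le; have := y'.right_le
  have hz : 1 ≤ max y.left y'.left ∧ max y.left y'.left ≤ max y.right y'.right ∧
      max y.right y'.right ≤ n := by
    unfold Linked at *; omega
  rw [ofEnds_eq_single hz]
  rcases le_total y'.right y.right with hd | hd
  · have key := isCokernelObject_lift_single_single h h' hd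
      (z := ⟨_, _, hz.1, hz.2.1, hz.2.2⟩) rfl (max_eq_left hd)
    rw [min_eq_right hd]
    have e : biprod.lift (φ ≫ biprod.fst) (φ ≫ biprod.snd) = φ := by
      apply biprod.hom_ext <;> simp
    rw [e] at key
    exact key.of_iso (biprod.braiding _ _)
  · have key := isCokernelObject_lift_single_single h' h hd
      (z := ⟨_, _, hz.1, hz.2.1, hz.2.2⟩) (max_comm _ _) (max_eq_right hd)
    rw [min_eq_left hd]
    have e : biprod.lift (φ ≫ biprod.snd) (φ ≫ biprod.fst) =
        φ ≫ (biprod.braiding (single y) (single y')).hom := by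
      apply biprod.hom_ext <;> simp
    rw [e] at key
    exact key.of_target_iso.of_iso (biprod.braiding _ _)

end MultisetsOfIntervals

/-! ### Closure under cokernels. -/

namespace IsAdditiveSubcategory

open MultisetsOfIntervals IntervalOfType

variable {n : ℕ} {P : ObjectProperty (MultisetsOfIntervals n)}

lemma biprod (hP : IsAdditiveSubcategory P) {X Y : MultisetsOfIntervals n} (hX : P X)
    (hY : P Y) : P (X ⊞ Y) := by
  have := hP.directSums
  exact P.prop_of_isColimit (BinaryBiproduct.isColimit X Y) (by rintro ⟨_ | _⟩ <;> assumption)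

lemma of_iso (hP : IsAdditiveSubcategory P) {X Y : MultisetsOfIntervals n} (e : X ≅ Y)
    (hX : P X) : P Y := by
  have := hP.directSums
  have : P.IsClosedUnderIsomorphisms :=
    ObjectProperty.IsClosedUnderBinaryCoproducts.closedUnderIsomorphisms P
  exact P.prop_of_iso e hX

lemma left (hP : IsAdditiveSubcategory P) {M X Y : MultisetsOfIntervals n} (e : M ≅ X ⊞ Y)
    (hM : P M) : P X := hP.summands X Y (hP.of_iso e hM)

lemma right (hP : IsAdditiveSubcategory P) {M X Y : MultisetsOfIntervals n} (e : M ≅ X ⊞ Y)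
    (hM : P M) : P Y := hP.left (e ≪≫ biprod.braiding X Y) hM

/-- The cokernels of morphisms from an interval to at most two intervals belong to `P`. -/
structure HasSmallCokernels (P : ObjectProperty (MultisetsOfIntervals n)) : Prop where
  single {x y : IntervalOfType n} {φ : single x ⟶ single y} {Z : MultisetsOfIntervals n} :
    P (MultisetsOfIntervals.single x) → P (MultisetsOfIntervals.single y) →
      IsCokernelObject φ Z → P Z
  pair {x y y' : IntervalOfType n} {φ : MultisetsOfIntervals.single x ⟶
      MultisetsOfIntervals.single y ⊞ MultisetsOfIntervals.single y'}
      {Z : MultisetsOfIntervals n} :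
    P (MultisetsOfIntervals.single x) → P (MultisetsOfIntervals.single y) →
      P (MultisetsOfIntervals.single y') → IsCokernelObject φ Z → P Z

lemma exists_isCokernelObject_single (hP : IsAdditiveSubcategory P) (hs : HasSmallCokernels P)
    {x : IntervalOfType n} (hx : P (single x)) {Y : MultisetsOfIntervals n} (hY : P Y)
    (f : single x ⟶ Y) : ∃ Z, P Z ∧ IsCokernelObject f Z := by
  induction h : Fintype.card Y.ι generalizing Y with
  | zero =>
    have := Fintype.card_eq_zero_iff.1 h
    have h0 := isZero_of_isEmpty Y
    exact ⟨Y, hY, isCokernelObject_iff.2 ⟨𝟙 Y, h0.eq_of_tgt _ _, inferInstance,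
      fun W g _ => ⟨g, Category.id_comp g⟩⟩⟩
  | succ N ih =>
    have step (i : Y.ι) : ∃ Z, P Z ∧ IsCokernelObject (f ≫ projErase Y i) Z :=
      ih (hP.right (isoSingleBiprodErase Y i) hY) _ (by have := card_erase Y i; omega)
    have hlift (i : Y.ι) : f ≫ (isoSingleBiprodErase Y i).hom =
        biprod.lift (f ≫ projSingle Y i) (f ≫ projErase Y i) := by
      apply biprod.hom_ext <;> simp [isoSingleBiprodErase]
    have hmem (i : Y.ι) : P (single (Y.X i)) := hP.left (isoSingleBiprodErase Y i) hY
    by_cases hz : ∃ i, f PUnit.unit i = 0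
    · obtain ⟨i, hi⟩ := hz
      obtain ⟨Z, hZ, hc⟩ := step i
      have hfi : f ≫ projSingle Y i = 0 := by
        ext ⟨⟩ ⟨⟩
        exact (comp_projSingle_apply Y i f _ _).trans hi
      refine ⟨_, hP.biprod (hmem i) hZ, .of_target_iso (isoSingleBiprodErase Y i) ?_⟩
      rw [hlift, hfi]
      -- A zero component leaves its whole target as a summand.
      exact isCokernelObject_lift (𝟙 _) 0 (by simp) (fun W g _ _ => ⟨g, Category.id_comp g⟩) hc
    · push Not at hz
      have hne (i : Y.ι) : f ≫ projSingle Y i ≠ 0 := fun h0 =>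
        hz i ((comp_projSingle_apply Y i f PUnit.unit PUnit.unit).symm.trans
          (congrFun (congrFun h0 PUnit.unit) PUnit.unit))
      have : Nonempty Y.ι := Fintype.card_pos_iff.1 (by omega)
      obtain ⟨i, hi⟩ := Finite.exists_max fun j => (Y.X j).right
      rcases isEmpty_or_nonempty (erase Y i).ι with he | he
      · have hc := isCokernelObject_single_single _ (hne i)
        refine ⟨_, hs.single hx (hmem i) hc, ?_⟩
        refine .of_target_iso
          (isoSingleBiprodErase Y i ≪≫ (isoBiprodZero (isZero_of_isEmpty _)).symm) ?_
        convert hc using 1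
        simp [isoBiprodZero, isoSingleBiprodErase]
      · obtain ⟨k, hk⟩ := Finite.exists_min fun j => ((erase Y i).X j).left
        obtain ⟨Z, hZ, hc⟩ := step i
        have hl : Linked x (Y.X i) := linked_of_ne_zero (hz i)
        have hl' : Linked x (Y.X k.1) := linked_of_ne_zero (hz k.1)
        -- Both left ends are at most `x.right`, which is at most `(Y.X i).right`.
        have hb : 1 ≤ max (Y.X i).left (Y.X k.1).left ∧
            max (Y.X i).left (Y.X k.1).left ≤ (Y.X i).right := by
          have := (Y.X i).one_le_left
          have := hi k.1
          unfold Linked at *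
          omega
        let z : IntervalOfType n := ⟨_, _, hb.1, hb.2, (Y.X i).right_le⟩
        -- The key point: the summand split off from the full cokernel already occurs in the
        -- cokernel of the two components `i` and `k`.
        have hPz : P (single z) := hP.summands _ _ <| hs.pair hx (hmem i) (hmem k.1) <|
          isCokernelObject_lift_single_single (z := z) (hne i) (hne k.1) (hi k.1) rfl rfl
        refine ⟨_, hP.biprod hPz hZ, .of_target_iso (isoSingleBiprodErase Y i) ?_⟩
        rw [hlift]
        refine isCokernelObject_lift_single k (hne i) ?_ (hi k.1) (fun j _ => hk j) rfl rfl hc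
        intro h0
        exact hz k.1 ((comp_projErase_apply Y i f PUnit.unit k).symm.trans h0)

/-- The target must vary in the induction: after dividing out one source interval, the rest maps to
the cokernel `Z₁`, which is again in `P`. -/
lemma exists_isCokernelObject (hP : IsAdditiveSubcategory P) (hs : HasSmallCokernels P)
    (X : MultisetsOfIntervals n) : ∀ (_ : P X) {Y : MultisetsOfIntervals n} (_ : P Y)
      (f : X ⟶ Y), ∃ Z, P Z ∧ IsCokernelObject f Z := by
  induction X using MultisetsOfIntervals.induction_on with
  | zero M hM =>
    intro _ Y hY f
    exact ⟨Y, hY, isCokernelObject_iff.2 ⟨𝟙 Y, hM.eq_of_src _ _, inferInstance,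
      fun W g _ => ⟨g, Category.id_comp g⟩⟩⟩
  | biprod M M' x e ih =>
    intro hM Y hY f
    obtain ⟨Z₁, hZ₁, h₁⟩ := hP.exists_isCokernelObject_single hs (hP.left e hM) hY
      (biprod.inl ≫ e.inv ≫ f)
    obtain ⟨π, w, _, hπ⟩ := isCokernelObject_iff.1 h₁
    obtain ⟨Z₂, hZ₂, h₂⟩ := ih (hP.right e hM) hZ₁ ((biprod.inr ≫ e.inv ≫ f) ≫ π)
    exact ⟨Z₂, hZ₂, isCokernelObject_of_biprod e f π w hπ h₂⟩

lemma isClosedUnderCokernels (hP : IsAdditiveSubcategory P) (hs : HasSmallCokernels P) :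
    P.IsClosedUnderCokernels where
  cokernels_le := by
    rintro _ ⟨f, k, hk, hX, hY⟩
    obtain ⟨Z, hZ, π, w, ⟨hπ⟩⟩ := hP.exists_isCokernelObject hs _ hX hY f
    exact hP.of_iso (hπ.coconePointUniqueUpToIso hk) hZ

end IsAdditiveSubcategory

end
open MultisetsOfIntervals in
theorem mainTheorem7 (n : ℕ) (hn : 1 ≤ n) :
    -- the criterion
    (∀ P : ObjectProperty (MultisetsOfIntervals n), IsAdditiveSubcategory P →
      (∀ (X Y : MultisetsOfIntervals n) (φ : X ⟶ Y) (k : CokernelCofork φ),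
        Nonempty (IsColimit k) →
        Indecomposable X →
        (Indecomposable Y ∨ ∃ Y₁ Y₂ : MultisetsOfIntervals n,
          Indecomposable Y₁ ∧ Indecomposable Y₂ ∧ Nonempty (Y ≅ Y₁ ⊞ Y₂)) →
        P X → P Y → P k.pt) →
      P.IsClosedUnderCokernels) ∧
    -- the cokernel of a non-zero morphism `[a, b] ⟶ [c, d]`
    (∀ (x y : IntervalOfType n) (φ : single x ⟶ single y), φ ≠ 0 →
      IsCokernelObject φ (ofEnds n (x.right + 1) y.right)) ∧
    -- the cokernel of a morphism `[a, b] ⟶ [c, d] ⊕ [c', d']` with non-zero components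
    (∀ (x y y' : IntervalOfType n) (φ : single x ⟶ single y ⊞ single y'),
      φ ≫ biprod.fst ≠ 0 → φ ≫ biprod.snd ≠ 0 →
      IsCokernelObject φ
        (ofEnds n (x.right + 1) (min y.right y'.right) ⊞
          ofEnds n (max y.left y'.left) (max y.right y'.right))) := by
  refine ⟨fun P hP h => hP.isClosedUnderCokernels ⟨?_, ?_⟩,
    fun x y φ hφ => isCokernelObject_single_single φ hφ,
    fun x y y' φ h h' => isCokernelObject_single_biprod φ h h'⟩
  · rintro x y φ Z hx hy ⟨π, w, hk⟩
    exact h _ _ φ _ hk (indecomposable_single x) (Or.inl (indecomposable_single y)) hx hy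
  · rintro x y y' φ Z hx hy hy' ⟨π, w, hk⟩
    exact h _ _ φ _ hk (indecomposable_single x) (Or.inr ⟨_, _, indecomposable_single y,
      indecomposable_single y', ⟨Iso.refl _⟩⟩) hx (hP.biprod hy hy')
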